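/- Let $k\ge 1$ be an integer and let $G$ be a finite simple graph of order $n$ with minimum degree $\delta\ge 2k+2$ and maximum degree $\Delta$. Let $A(G)$ be the adjacency matrix of $G$ and $D(G)$ the diagonal matrix of its vertex degrees. Let $\mu_i(G)$ and $q_i(G)$ denote the $i$-th largest eigenvalue, counted with multiplicity, of the Laplacian matrix $D(G)-A(G)$ and of the signless Laplacian matrix $D(G)+A(G)$, respectively. For a positive integer $d$, say that $G$ has property $P(k,d)$ if $G$ contains $k$ pairwise edge-disjoint spanning trees and another forest $F$, edge-disjoint from these trees, such that $|E(F)|>\frac{d-1}{d}(n-1)$ and, if $F$ is not a spanning tree of $G$, then $F$ has a component with at least $d$ edges. Then: (i) if $q_2(G)<2\delta-\dfrac{2\left(k+\frac{\delta-1}{\delta}\right)}{\delta+1}$, then $G$ has property $P(k,\delta)$; (ii) if $\mu_{n-1}(G)>\Delta-\delta+\dfrac{2\left(k+\frac{\delta-1}{\delta}\right)}{\delta+1}$, then $G$ has property $P(k,\delta)$. -/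

import Mathlib

namespace SimpleGraph

/-- The signless Laplacian matrix `Q(G) = D(G) + A(G)` over the reals. -/
def signlessLapMatrix {V : Type*} [Fintype V] [DecidableEq V] (G : SimpleGraph V)
    [DecidableRel G.Adj] : Matrix V V ℝ :=
  G.degMatrix ℝ + G.adjMatrix ℝ

theorem isHermitian_signlessLapMatrix {V : Type*} [Fintype V] [DecidableEq V]
    (G : SimpleGraph V) [DecidableRel G.Adj] : G.signlessLapMatrix.IsHermitian := by
  have h : G.signlessLapMatrix.IsSymm := (G.isSymm_degMatrix ℝ).add G.isSymm_adjMatrix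
  rw [Matrix.IsHermitian, Matrix.conjTranspose_eq_transpose_of_trivial]
  exact h

/-- The `i`-th largest eigenvalue (`i = 1, …, n`, counted with multiplicity) of a real symmetric
`n × n` matrix. Outside `1 ≤ i ≤ n` the value is the junk value `0`. -/
noncomputable def ithLargestEigenvalue {V : Type*} [Fintype V] [DecidableEq V]
    {M : Matrix V V ℝ} (hM : M.IsHermitian) (i : ℕ) : ℝ :=
  if h : 1 ≤ i ∧ i ≤ Fintype.card V then hM.eigenvalues₀ ⟨i - 1, by omega⟩ else 0

/-- `μ_i(G)`, the `i`-th largest eigenvalue of the Laplacian matrix `L(G) = D(G) - A(G)`. -/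
noncomputable def lapEigenvalue {V : Type*} [Fintype V] [DecidableEq V] (G : SimpleGraph V)
    [DecidableRel G.Adj] (i : ℕ) : ℝ :=
  ithLargestEigenvalue (G.isHermitian_lapMatrix ℝ) i

/-- `q_i(G)`, the `i`-th largest eigenvalue of the signless Laplacian matrix of `G`. -/
noncomputable def signlessLapEigenvalue {V : Type*} [Fintype V] [DecidableEq V]
    (G : SimpleGraph V) [DecidableRel G.Adj] (i : ℕ) : ℝ :=
  ithLargestEigenvalue G.isHermitian_signlessLapMatrix i

/-- Property `P(k, d)`: `G` contains `k` pairwise edge-disjoint spanning trees `T 0, …, T (k - 1)`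
and a further forest `F`, edge-disjoint from all of them, with more than `(d - 1) / d * (n - 1)`
edges, such that if `F` is not a spanning tree, then some component of `F` has at least `d` edges.
Subgraphs of `G` are given as graphs on the whole vertex set, so `F` may have isolated vertices,
which affects neither its edges nor whether some component has at least `d ≥ 1` edges. -/
def HasPropertyP {V : Type*} [Fintype V] (G : SimpleGraph V) (k d : ℕ) : Prop :=
  ∃ (T : Fin k → SimpleGraph V) (F : SimpleGraph V),
    (∀ i, T i ≤ G ∧ (T i).IsTree) ∧
    (∀ i j, i ≠ j → Disjoint (T i).edgeSet (T j).edgeSet) ∧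
    F ≤ G ∧ F.IsAcyclic ∧
    (∀ i, Disjoint (T i).edgeSet F.edgeSet) ∧
    (F.edgeSet.ncard : ℝ) > ((d : ℝ) - 1) / (d : ℝ) * ((Fintype.card V : ℝ) - 1) ∧
    (¬ F.IsTree → ∃ C : F.ConnectedComponent, d ≤ C.toSimpleGraph.edgeSet.ncard)

end SimpleGraph

/-! Put τ = 2(k + (δ-1)/δ)/(δ+1). Since Q = 2D - L, and since Δ ≥ δ, either spectral hypothesis
forces every plane to contain a vector x with xᵀLx > τ|x|² (`exists_lapMatrix_gt`).

Partition the vertices into s parts, l of them with at least δ+1 vertices. The planes spanned by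
indicators of two large parts show that the boundaries of the large parts sum to at least
τ(δ+1)(l-1) = 2(k+1-1/δ)(l-1) (`le_sum_partBoundary`). A small part is left by at least δ ≥ 2k+2
edges. Hence at least (k+1)(s-1) - (l-1)/δ edges cross the partition
(`card_edges_between_components`), where l ≤ m = ⌊n/(δ+1)⌋.

So the Nash-Williams–Tutte condition for k+1 trees fails by at most D = ⌊(m-1)/δ⌋, while the one for
k trees holds. Matroid union, with one graphic matroid truncated to rank n-1-D, gives k spanning
trees and a forest with D+1 components (`exists_trees_and_forest`). As D is small compared with n/δ,
the forest has enough edges, and by pigeonhole a component with more than δ vertices. -/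

/-! ### Polymatroids, Rado's theorem and matroid union -/

/-- The rank function of an integer polymatroid: normalised, monotone and submodular. -/
structure IsPolymatroidRank {α : Type*} [DecidableEq α] (r : Finset α → ℕ) : Prop where
  empty : r ∅ = 0
  mono : Monotone r
  submod : ∀ A B, r (A ∪ B) + r (A ∩ B) ≤ r A + r B

namespace IsPolymatroidRank

theorem card {α : Type*} [DecidableEq α] : IsPolymatroidRank (fun A : Finset α => A.card) where
  empty := rfl
  mono := Finset.card_mono
  submod A B := (Finset.card_union_add_card_inter A B).le

/-- Used both for the uniform matroid that absorbs leftover elements and for the forest that is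
short of spanning. -/
theorem truncate {α : Type*} [DecidableEq α] {r : Finset α → ℕ} (h : IsPolymatroidRank r) (m : ℕ) :
    IsPolymatroidRank (fun A => min (r A) m) where
  empty := by simp [h.empty]
  mono A B hAB := min_le_min_right m (h.mono hAB)
  submod A B := by
    have h1 := h.submod A B
    have h2 : r (A ∩ B) ≤ r A := h.mono Finset.inter_subset_left
    have h3 : r (A ∩ B) ≤ r B := h.mono Finset.inter_subset_right
    have h4 : r A ≤ r (A ∪ B) := h.mono Finset.subset_union_left
    have h5 : r B ≤ r (A ∪ B) := h.mono Finset.subset_union_right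
    omega

/-- A member of a family satisfying Rado's condition, if it has two elements, can be shrunk. -/
theorem exists_rado_shrink {ι β : Type*} [DecidableEq ι] [DecidableEq β] {r : Finset β → ℕ}
    (h : IsPolymatroidRank r) (E : Finset ι) (A : ι → Finset β)
    (hA : ∀ J ⊆ E, J.card ≤ r (J.biUnion A)) {e : ι} (he : e ∈ E) {x y : β} (hx : x ∈ A e)
    (hy : y ∈ A e) (hxy : x ≠ y) :
    ∃ z ∈ A e, ∀ J ⊆ E, J.card ≤ r (J.biUnion (Function.update A e ((A e).erase z))) := by
  by_contra! hcon
  obtain ⟨J₁, hJ₁, h₁⟩ := hcon x hx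
  obtain ⟨J₂, hJ₂, h₂⟩ := hcon y hy
  have key : ∀ (z : β) (J : Finset ι), J ⊆ E →
      r (J.biUnion (Function.update A e ((A e).erase z))) < J.card → e ∈ J := by
    intro z J hJ hlt
    by_contra heJ
    refine (hA J hJ).not_gt (lt_of_eq_of_lt ?_ hlt)
    congr 1
    refine Finset.biUnion_congr rfl fun i hi => ?_
    rw [Function.update_of_ne (by rintro rfl; exact heJ hi)]
  have he₁ := key x J₁ hJ₁ h₁
  have he₂ := key y J₂ hJ₂ h₂
  set S₁ := J₁.biUnion (Function.update A e ((A e).erase x)) with hS₁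
  set S₂ := J₂.biUnion (Function.update A e ((A e).erase y)) with hS₂
  have hmem : ∀ (z : β) (i : ι) (b : β), b ∈ A i → (i = e → b ≠ z) →
      b ∈ Function.update A e ((A e).erase z) i := by
    intro z i b hb hz
    by_cases hi : i = e
    · subst hi; simp [hb, hz rfl]
    · simpa [hi] using hb
  have hu : (J₁ ∪ J₂).biUnion A ⊆ S₁ ∪ S₂ := by
    intro b hb
    obtain ⟨i, hi, hbi⟩ := Finset.mem_biUnion.1 hb
    rw [Finset.mem_union, hS₁, hS₂, Finset.mem_biUnion, Finset.mem_biUnion]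
    by_cases hie : i = e
    · subst hie
      by_cases hbx : b = x
      · exact Or.inr ⟨i, he₂, hmem y i b hbi fun _ => by rw [hbx]; exact hxy⟩
      · exact Or.inl ⟨i, he₁, hmem x i b hbi fun _ => hbx⟩
    · rcases Finset.mem_union.1 hi with hi | hi
      · exact Or.inl ⟨i, hi, hmem x i b hbi fun h => absurd h hie⟩
      · exact Or.inr ⟨i, hi, hmem y i b hbi fun h => absurd h hie⟩
  have hi : ((J₁ ∩ J₂).erase e).biUnion A ⊆ S₁ ∩ S₂ := by
    intro b hb
    obtain ⟨i, hi, hbi⟩ := Finset.mem_biUnion.1 hb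
    rw [Finset.mem_erase, Finset.mem_inter] at hi
    rw [Finset.mem_inter, hS₁, hS₂, Finset.mem_biUnion, Finset.mem_biUnion]
    exact ⟨⟨i, hi.2.1, hmem x i b hbi fun h => absurd h hi.1⟩,
      ⟨i, hi.2.2, hmem y i b hbi fun h => absurd h hi.1⟩⟩
  -- Submodularity bounds r(S₁) + r(S₂) below by |J₁ ∪ J₂| + |J₁ ∩ J₂| - 1 = |J₁| + |J₂| - 1, but
  -- the two violations bound it above by |J₁| + |J₂| - 2.
  have c₁ := (hA (J₁ ∪ J₂) (Finset.union_subset hJ₁ hJ₂)).trans (h.mono hu)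
  have c₂ := (hA ((J₁ ∩ J₂).erase e) (((Finset.erase_subset _ _).trans
    Finset.inter_subset_left).trans hJ₁)).trans (h.mono hi)
  rw [Finset.card_erase_of_mem (Finset.mem_inter.2 ⟨he₁, he₂⟩)] at c₂
  have c₃ := Finset.card_union_add_card_inter J₁ J₂
  have c₄ := h.submod S₁ S₂
  omega

/-- **Rado's theorem** for integer polymatroids. -/
theorem exists_rado {ι β : Type*} [DecidableEq ι] [DecidableEq β] {r : Finset β → ℕ}
    (h : IsPolymatroidRank r) (E : Finset ι) (A : ι → Finset β)
    (hA : ∀ J ⊆ E, J.card ≤ r (J.biUnion A)) :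
    ∃ B : ι → Finset β, (∀ i, B i ⊆ A i) ∧ (∀ i ∈ E, (B i).card = 1) ∧
      E.card ≤ r (E.biUnion B) := by
  induction hn : ∑ i ∈ E, (A i).card using Nat.strong_induction_on generalizing A with
  | _ n ih =>
  have hne : ∀ i ∈ E, (A i).Nonempty := by
    intro i hi
    rw [Finset.nonempty_iff_ne_empty]
    intro h0
    have := hA {i} (by simpa using hi)
    simp [h0, h.empty] at this
  by_cases hone : ∀ i ∈ E, (A i).card = 1
  · exact ⟨A, fun i => subset_rfl, hone, hA E subset_rfl⟩
  push Not at hone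
  obtain ⟨e, he, hcard⟩ := hone
  have hpos := (hne e he).card_pos
  obtain ⟨x, hx, y, hy, hxy⟩ := Finset.one_lt_card.1 (show 1 < (A e).card by omega)
  obtain ⟨z, hz, hz'⟩ := h.exists_rado_shrink E A hA he hx hy hxy
  have hsub : ∀ i, Function.update A e ((A e).erase z) i ⊆ A i := by
    intro i
    by_cases hi : i = e
    · subst hi; simpa using Finset.erase_subset _ _
    · simp [hi]
  have hlt : ∑ i ∈ E, (Function.update A e ((A e).erase z) i).card < n := by
    rw [← hn]
    refine Finset.sum_lt_sum (fun i _ => Finset.card_le_card (hsub i)) ⟨e, he, ?_⟩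
    simpa using Finset.card_erase_lt_of_mem hz
  obtain ⟨B, hB, hB1, hcard⟩ := ih _ hlt _ hz' rfl
  exact ⟨B, fun i => (hB i).trans (hsub i), hB1, hcard⟩

end IsPolymatroidRank

/-- The elements paired with `c` in a finite set of pairs. -/
def Finset.sndFiber {α κ : Type*} [DecidableEq α] [DecidableEq κ] (S : Finset (α × κ)) (c : κ) :
    Finset α :=
  (S.filter fun p => p.2 = c).image Prod.fst

theorem Finset.mem_sndFiber {α κ : Type*} [DecidableEq α] [DecidableEq κ] {S : Finset (α × κ)} {c : κ}
    {x : α} : x ∈ S.sndFiber c ↔ (x, c) ∈ S := by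
  simp [Finset.sndFiber]

/-- Putting one matroid on each copy of the ground set reduces matroid union to Rado's theorem on `α
× κ`. -/
theorem IsPolymatroidRank.sum_sndFiber {α κ : Type*} [DecidableEq α] [DecidableEq κ] [Fintype κ]
    {r : κ → Finset α → ℕ} (h : ∀ c, IsPolymatroidRank (r c)) :
    IsPolymatroidRank (fun S : Finset (α × κ) => ∑ c, r c (S.sndFiber c)) where
  empty := Finset.sum_eq_zero fun c _ => by
    rw [show (∅ : Finset (α × κ)).sndFiber c = ∅ from rfl, (h c).empty]
  mono S T hST := Finset.sum_le_sum fun c _ => (h c).mono fun x hx =>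
    Finset.mem_sndFiber.2 (hST (Finset.mem_sndFiber.1 hx))
  submod S T := by
    simp only [← Finset.sum_add_distrib]
    refine Finset.sum_le_sum fun c _ => ?_
    rw [show (S ∪ T).sndFiber c = S.sndFiber c ∪ T.sndFiber c by ext; simp [Finset.mem_sndFiber],
      show (S ∩ T).sndFiber c = S.sndFiber c ∩ T.sndFiber c by ext; simp [Finset.mem_sndFiber]]
    exact (h c).submod _ _

/-- The matroid union theorem, covering form: colour the elements of `E` so that the colour
classes have total rank at least `|E|`. -/
theorem IsPolymatroidRank.exists_coloring {α κ : Type*} [DecidableEq α] [DecidableEq κ] [Fintype κ]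
    {r : κ → Finset α → ℕ} (h : ∀ c, IsPolymatroidRank (r c)) (E : Finset α)
    (hE : ∀ J ⊆ E, J.card ≤ ∑ c, r c J) :
    ∃ S : κ → Finset α, (∀ c, S c ⊆ E) ∧ (∀ c c', c ≠ c' → Disjoint (S c) (S c')) ∧
      E.card ≤ ∑ c, r c (S c) := by
  -- A representative of {e} × κ is a choice of colour for e.
  obtain ⟨B, hB, hB1, hcard⟩ := (IsPolymatroidRank.sum_sndFiber h).exists_rado E
    (fun e => Finset.univ.image (Prod.mk e)) (fun J hJ => by
      refine (hE J hJ).trans (Finset.sum_le_sum fun c _ => (h c).mono fun x hx => ?_)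
      simpa [Finset.mem_sndFiber] using hx)
  have key : ∀ c x, x ∈ (E.biUnion B).sndFiber c → x ∈ E ∧ (x, c) ∈ B x := by
    intro c x hx
    rw [Finset.mem_sndFiber, Finset.mem_biUnion] at hx
    obtain ⟨i, hi, hxi⟩ := hx
    have := hB i hxi
    simp only [Finset.mem_image, Finset.mem_univ, true_and, Prod.mk.injEq] at this
    obtain ⟨_, rfl, -⟩ := this
    exact ⟨hi, hxi⟩
  refine ⟨fun c => (E.biUnion B).sndFiber c, fun c x hx => (key c x hx).1,
    fun c c' hcc => Finset.disjoint_left.2 fun x hx hx' => hcc ?_, hcard⟩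
  have := Finset.card_le_one.1 (hB1 x (key c x hx).1).le _ (key c x hx).2 _ (key c' x hx').2
  exact (Prod.mk.inj this).2

/-- The matroid union theorem, packing form: disjoint bases of several matroids on `E`. -/
theorem IsPolymatroidRank.exists_disjoint_bases {α κ : Type*} [DecidableEq α] [DecidableEq κ]
    [Fintype κ] {r : κ → Finset α → ℕ} (h : ∀ c, IsPolymatroidRank (r c))
    (hcard : ∀ c A, r c A ≤ A.card) (E : Finset α)
    (hE : ∀ J ⊆ E, ∑ c, r c E ≤ ∑ c, r c J + (E \ J).card) :
    ∃ S : κ → Finset α, (∀ c, S c ⊆ E) ∧ (∀ c c', c ≠ c' → Disjoint (S c) (S c')) ∧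
      ∀ c, (S c).card = r c E ∧ r c (S c) = r c E := by
  -- A uniform matroid of rank u is added as an extra colour, to absorb the elements outside the
  -- bases.
  set u := E.card - ∑ c, r c E with hu
  have hle : ∑ c, r c E ≤ E.card := by
    simpa [(h _).empty] using hE ∅ (Finset.empty_subset _)
  let r' : Option κ → Finset α → ℕ := fun o A => o.elim (min A.card u) (fun c => r c A)
  have h' : ∀ o, IsPolymatroidRank (r' o) := by
    rintro (_ | c)
    · exact IsPolymatroidRank.card.truncate u
    · exact h c
  obtain ⟨S, hSE, hdisj, hS⟩ := IsPolymatroidRank.exists_coloring h' E (by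
    intro J hJ
    have h1 := hE J hJ
    have h2 := Finset.card_sdiff_add_card_eq_card hJ
    simp only [Fintype.sum_option, r', Option.elim]
    omega)
  simp only [Fintype.sum_option, r', Option.elim] at hS
  have htot : (S none).card + ∑ c, (S (some c)).card ≤ E.card := by
    rw [← Fintype.sum_option (fun o => (S o).card),
      ← Finset.card_biUnion (fun o _ o' _ hoo => hdisj o o' hoo)]
    exact Finset.card_le_card (Finset.biUnion_subset.2 fun o _ => hSE o)
  have h1 : ∀ c ∈ Finset.univ, r c (S (some c)) ≤ r c E := fun c _ => (h c).mono (hSE _)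
  have h2 : ∀ c ∈ Finset.univ, r c (S (some c)) ≤ (S (some c)).card := fun c _ => hcard c _
  -- The colouring bound is tight, so each class is both spanning (e1) and independent (e2).
  have e1 := (Finset.sum_eq_sum_iff_of_le h1).1 (le_antisymm (Finset.sum_le_sum h1) (by omega))
  have e2 := (Finset.sum_eq_sum_iff_of_le h2).1 (le_antisymm (Finset.sum_le_sum h2) (by omega))
  refine ⟨fun c => S (some c), fun c => hSE _, fun c c' hcc => hdisj _ _ (by simpa using hcc),
    fun c => ⟨?_, e1 c (Finset.mem_univ c)⟩⟩
  rw [← e2 c (Finset.mem_univ c), e1 c (Finset.mem_univ c)]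

/-! ### The graphic matroid and packing of trees and a forest -/

namespace SimpleGraph

/-- The functions on the vertices that are constant along every edge. -/
def edgeConstant {V : Type*} (H : SimpleGraph V) : Submodule ℝ (V → ℝ) where
  carrier := {x | ∀ u v, H.Adj u v → x u = x v}
  add_mem' hx hy u v h := by simp [hx u v h, hy u v h]
  zero_mem' u v _ := rfl
  smul_mem' c x hx u v h := by simp [hx u v h]

theorem mem_edgeConstant {V : Type*} {H : SimpleGraph V} {x : V → ℝ} :
    x ∈ H.edgeConstant ↔ ∀ u v, H.Adj u v → x u = x v := Iff.rfl

theorem eq_of_mem_edgeConstant {V : Type*} {H : SimpleGraph V} {x : V → ℝ}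
    (hx : x ∈ H.edgeConstant) {u v : V} (h : H.Reachable u v) : x u = x v := by
  obtain ⟨p⟩ := h
  induction p with
  | nil => rfl
  | cons hadj _ ih => exact (hx _ _ hadj).trans ih

theorem edgeConstant_anti {V : Type*} {H H' : SimpleGraph V} (h : H ≤ H') :
    H'.edgeConstant ≤ H.edgeConstant := fun _ hx u v huv => hx u v (h huv)

theorem edgeConstant_sup {V : Type*} (H H' : SimpleGraph V) :
    (H ⊔ H').edgeConstant = H.edgeConstant ⊓ H'.edgeConstant := by
  refine le_antisymm (le_inf (edgeConstant_anti le_sup_left) (edgeConstant_anti le_sup_right)) ?_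
  rintro x ⟨hx, hx'⟩ u v (h | h)
  exacts [hx u v h, hx' u v h]

theorem finrank_edgeConstant {V : Type*} [Fintype V] (H : SimpleGraph V) :
    Module.finrank ℝ H.edgeConstant = Nat.card H.ConnectedComponent := by
  classical
  rw [Nat.card_eq_fintype_card, card_connectedComponent_eq_finrank_ker_toLin'_lapMatrix]
  rw [show H.edgeConstant = LinearMap.ker (Matrix.toLin' (lapMatrix ℝ H)) by
    ext x
    rw [LinearMap.mem_ker, Matrix.toLin'_apply, lapMatrix_mulVec_eq_zero_iff_forall_adj]
    rfl]

theorem card_connectedComponent_anti {V : Type*} [Fintype V] {H H' : SimpleGraph V} (h : H ≤ H') :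
    Nat.card H'.ConnectedComponent ≤ Nat.card H.ConnectedComponent := by
  rw [← finrank_edgeConstant, ← finrank_edgeConstant]
  exact Submodule.finrank_mono (edgeConstant_anti h)

/-- This is the dimension formula for the spaces of edge-constant functions: joining graphs
intersects the spaces, and the sum of the spaces lies in that of the meet. -/
theorem card_connectedComponent_supermod {V : Type*} [Fintype V] (H H' : SimpleGraph V) :
    Nat.card H.ConnectedComponent + Nat.card H'.ConnectedComponent ≤
      Nat.card (H ⊔ H').ConnectedComponent + Nat.card (H ⊓ H').ConnectedComponent := by
  simp only [← finrank_edgeConstant]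
  rw [← Submodule.finrank_sup_add_finrank_inf_eq, ← edgeConstant_sup, add_comm]
  exact Nat.add_le_add_left (Submodule.finrank_mono
    (sup_le (edgeConstant_anti inf_le_left) (edgeConstant_anti inf_le_right))) _

theorem card_connectedComponent_le {V : Type*} [Fintype V] (H : SimpleGraph V) :
    Nat.card H.ConnectedComponent ≤ Fintype.card V := by
  rw [← finrank_edgeConstant]
  simpa using Submodule.finrank_le H.edgeConstant

theorem card_connectedComponent_bot {V : Type*} [Fintype V] :
    Nat.card (⊥ : SimpleGraph V).ConnectedComponent = Fintype.card V := by
  rw [← finrank_edgeConstant, show (⊥ : SimpleGraph V).edgeConstant = ⊤ by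
    ext x; simp [mem_edgeConstant]]
  simp

/-- A single edge imposes one linear equation x u = x v. -/
theorem card_le_card_connectedComponent_singleton_add_one {V : Type*} [Fintype V] (e : Sym2 V) :
    Fintype.card V ≤ Nat.card (fromEdgeSet {e}).ConnectedComponent + 1 := by
  induction e with
  | _ u v =>
  let φ : (V → ℝ) →ₗ[ℝ] ℝ := LinearMap.proj (R := ℝ) (φ := fun _ => ℝ) u - LinearMap.proj v
  have h1 := φ.finrank_range_add_finrank_ker
  have h2 : Module.finrank ℝ (LinearMap.range φ) ≤ 1 := by
    simpa using Submodule.finrank_le (LinearMap.range φ)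
  have h3 : LinearMap.ker φ ≤ (fromEdgeSet {s(u, v)}).edgeConstant := by
    intro x hx a b hab
    have hx' : x u = x v := by simpa [φ, sub_eq_zero] using hx
    simp only [fromEdgeSet_adj, Set.mem_singleton_iff, Sym2.eq_iff] at hab
    rcases hab with ⟨⟨rfl, rfl⟩ | ⟨rfl, rfl⟩, -⟩
    exacts [hx', hx'.symm]
  have h4 := Submodule.finrank_mono h3
  rw [finrank_edgeConstant] at h4
  simp only [Module.finrank_fintype_fun_eq_card] at h1
  omega

/-- The rank of a set of edges in the graphic matroid of the complete graph. -/
noncomputable def graphicRank {V : Type*} [Fintype V] (A : Finset (Sym2 V)) : ℕ :=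
  Fintype.card V - Nat.card (fromEdgeSet (A : Set (Sym2 V))).ConnectedComponent

theorem graphicRank_add_card {V : Type*} [Fintype V] (A : Finset (Sym2 V)) :
    graphicRank A + Nat.card (fromEdgeSet (A : Set (Sym2 V))).ConnectedComponent =
      Fintype.card V :=
  Nat.sub_add_cancel (card_connectedComponent_le _)

theorem isPolymatroidRank_graphicRank {V : Type*} [Fintype V] [DecidableEq V] :
    IsPolymatroidRank (graphicRank (V := V)) where
  empty := by
    rw [graphicRank, Finset.coe_empty, fromEdgeSet_empty, card_connectedComponent_bot, Nat.sub_self]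
  mono A B hAB := Nat.sub_le_sub_left (card_connectedComponent_anti
    (fromEdgeSet_mono (by exact_mod_cast hAB))) _
  submod A B := by
    have h := card_connectedComponent_supermod (fromEdgeSet (A : Set (Sym2 V)))
      (fromEdgeSet (B : Set (Sym2 V)))
    rw [← fromEdgeSet_union, ← fromEdgeSet_inter, ← Finset.coe_union, ← Finset.coe_inter] at h
    have h1 := graphicRank_add_card A
    have h2 := graphicRank_add_card B
    have h3 := graphicRank_add_card (A ∪ B)
    have h4 := graphicRank_add_card (A ∩ B)
    omega

theorem graphicRank_le_card {V : Type*} [Fintype V] [DecidableEq V] (A : Finset (Sym2 V)) :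
    graphicRank A ≤ A.card := by
  induction A using Finset.induction_on with
  | empty => simp [isPolymatroidRank_graphicRank.empty]
  | insert e A he ih =>
    have h1 := isPolymatroidRank_graphicRank.submod {e} A
    have h2 := graphicRank_add_card ({e} : Finset (Sym2 V))
    have h3 := card_le_card_connectedComponent_singleton_add_one e
    rw [Finset.coe_singleton] at h2
    rw [Finset.card_insert_of_notMem he, Finset.insert_eq]
    omega

/-- Deleting a non-bridge would leave the components, hence the rank, unchanged, making the rank
exceed the number of remaining edges. -/
theorem isAcyclic_of_card_eq_graphicRank {V : Type*} [Fintype V] [DecidableEq V]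
    {A : Finset (Sym2 V)} (hA : A.card = graphicRank A) :
    (fromEdgeSet (A : Set (Sym2 V))).IsAcyclic := by
  rw [isAcyclic_iff_forall_adj_isBridge]
  intro u v huv
  rw [isBridge_iff]
  intro hreach
  have huvA : s(u, v) ∈ A := by simpa using ((fromEdgeSet_adj _).1 huv).1
  rw [deleteEdges_fromEdgeSet, ← Finset.coe_singleton, ← Finset.coe_sdiff,
    Finset.sdiff_singleton_eq_erase] at hreach
  have hle : Nat.card (fromEdgeSet ((A.erase s(u, v) : Finset _) :
      Set (Sym2 V))).ConnectedComponent ≤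
      Nat.card (fromEdgeSet (A : Set (Sym2 V))).ConnectedComponent := by
    rw [← finrank_edgeConstant, ← finrank_edgeConstant]
    refine Submodule.finrank_mono fun x hx a b hab => ?_
    by_cases he : s(a, b) = s(u, v)
    · rcases Sym2.eq_iff.1 he with ⟨rfl, rfl⟩ | ⟨rfl, rfl⟩
      exacts [eq_of_mem_edgeConstant hx hreach, (eq_of_mem_edgeConstant hx hreach).symm]
    · refine hx a b ?_
      simp only [fromEdgeSet_adj, Finset.mem_coe] at hab ⊢
      exact ⟨Finset.mem_erase.2 ⟨he, hab.1⟩, hab.2⟩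
  have h1 := graphicRank_add_card (A.erase s(u, v))
  have h2 := graphicRank_add_card A
  have h3 := graphicRank_le_card (A.erase s(u, v))
  have h4 := Finset.card_erase_add_one huvA
  omega

theorem connected_of_card_connectedComponent_le_one {V : Type*} [Finite V] [Nonempty V]
    {H : SimpleGraph V} (h : Nat.card H.ConnectedComponent ≤ 1) : H.Connected := by
  have := (Finite.card_le_one_iff_subsingleton).1 h
  exact ⟨fun u v => ConnectedComponent.exact (Subsingleton.elim _ _)⟩

theorem edgeSet_fromEdgeSet_of_subset {V : Type*} [Fintype V] [DecidableEq V] {G : SimpleGraph V}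
    [DecidableRel G.Adj] {A : Finset (Sym2 V)} (hA : A ⊆ G.edgeFinset) :
    (fromEdgeSet (A : Set (Sym2 V))).edgeSet = A := by
  rw [edgeSet_fromEdgeSet, sdiff_eq_left, Set.disjoint_left]
  intro e he
  exact G.not_isDiag_of_mem_edgeSet (mem_edgeFinset.1 (hA he))

/-- Packing `k` spanning trees and a forest with `D + 1` components (a deficiency version of the
theorem of Nash-Williams and Tutte). -/
theorem exists_trees_and_forest {V : Type*} [Fintype V] [DecidableEq V] [Nonempty V]
    (G : SimpleGraph V) [DecidableRel G.Adj] {k D : ℕ} (hk : 1 ≤ k) (hD : D + 1 ≤ Fintype.card V)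
    (h₁ : ∀ H ≤ G, k * (Nat.card H.ConnectedComponent - 1) ≤ (G \ H).edgeSet.ncard)
    (h₂ : ∀ H ≤ G, (k + 1) * (Nat.card H.ConnectedComponent - 1) ≤ (G \ H).edgeSet.ncard + D) :
    ∃ (T : Fin k → SimpleGraph V) (F : SimpleGraph V),
      (∀ i, T i ≤ G ∧ (T i).IsTree) ∧
      (∀ i j, i ≠ j → Disjoint (T i).edgeSet (T j).edgeSet) ∧
      F ≤ G ∧ F.IsAcyclic ∧ (∀ i, Disjoint (T i).edgeSet F.edgeSet) ∧
      F.edgeSet.ncard + (D + 1) = Fintype.card V ∧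
      Nat.card F.ConnectedComponent = D + 1 := by
  -- The colour `none` carries the forest; its matroid is truncated to rank n - 1 - D.
  let r : Option (Fin k) → Finset (Sym2 V) → ℕ := fun o A =>
    o.elim (min (graphicRank A) (Fintype.card V - 1 - D)) (fun _ => graphicRank A)
  have hr : ∀ o, IsPolymatroidRank (r o) := by
    rintro (_ | i)
    · exact isPolymatroidRank_graphicRank.truncate _
    · exact isPolymatroidRank_graphicRank
  have hrc : ∀ o A, r o A ≤ A.card := by
    rintro (_ | i) A
    · exact (min_le_left _ _).trans (graphicRank_le_card A)
    · exact graphicRank_le_card A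
  have hE : fromEdgeSet (G.edgeFinset : Set (Sym2 V)) = G := by simp
  -- With H = G no edge crosses, so `h₁` and k ≥ 1 force G to be connected.
  have hrE : graphicRank G.edgeFinset + 1 = Fintype.card V := by
    have h := h₁ G le_rfl
    have h' := graphicRank_add_card G.edgeFinset
    rw [hE] at h'
    have hpos : 0 < Nat.card G.ConnectedComponent := Nat.card_pos
    simp only [sdiff_self, edgeSet_bot, Set.ncard_empty, Nat.le_zero, mul_eq_zero] at h
    change k = 0 ∨ _ at h
    omega
  -- The packing condition for J splits by whether the truncation is active at J: if so it is `h₁`,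
  -- otherwise `h₂`.
  obtain ⟨S, hSE, hdisj, hS⟩ := IsPolymatroidRank.exists_disjoint_bases hr hrc G.edgeFinset (by
    intro J hJ
    have hle : fromEdgeSet (J : Set (Sym2 V)) ≤ G := by
      rw [← hE]; exact fromEdgeSet_mono (by exact_mod_cast hJ)
    have hcard : (G \ fromEdgeSet (J : Set (Sym2 V))).edgeSet.ncard = (G.edgeFinset \ J).card := by
      rw [edgeSet_sdiff, edgeSet_fromEdgeSet_of_subset hJ, ← coe_edgeFinset, ← Finset.coe_sdiff,
        Set.ncard_coe_finset]
    have e1 := h₁ _ hle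
    have e2 := h₂ _ hle
    have e3 := graphicRank_add_card J
    have hpos : 0 < Nat.card (fromEdgeSet (J : Set (Sym2 V))).ConnectedComponent := Nat.card_pos
    rw [hcard] at e1 e2
    simp only [Fintype.sum_option, r, Option.elim, Finset.sum_const, Finset.card_univ,
      Fintype.card_fin, smul_eq_mul]
    obtain ⟨c, hc⟩ := Nat.exists_eq_add_of_lt hpos
    rw [hc] at e1 e2 e3
    have e4 : graphicRank G.edgeFinset = graphicRank J + c := by omega
    have e5 : k * (0 + c + 1 - 1) = k * c := by simp
    have e6 : (k + 1) * (0 + c + 1 - 1) = k * c + c := by simp [add_mul]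
    rw [e4, mul_add]
    omega)
  have hle : ∀ o, fromEdgeSet (S o : Set (Sym2 V)) ≤ G := fun o => by
    rw [← hE]; exact fromEdgeSet_mono (by exact_mod_cast hSE o)
  have hdisj' : ∀ o o', o ≠ o' → Disjoint (fromEdgeSet (S o : Set (Sym2 V))).edgeSet
      (fromEdgeSet (S o' : Set (Sym2 V))).edgeSet := by
    intro o o' hoo
    rw [edgeSet_fromEdgeSet_of_subset (hSE o), edgeSet_fromEdgeSet_of_subset (hSE o')]
    exact_mod_cast hdisj o o' hoo
  obtain ⟨hF1, hF2⟩ := hS none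
  have hF3 : r none G.edgeFinset = Fintype.card V - 1 - D := by
    simp only [r, Option.elim]
    omega
  have hF4 := min_le_left (graphicRank (S none)) (Fintype.card V - 1 - D)
  have hF5 := graphicRank_le_card (S none)
  change min (graphicRank (S none)) (Fintype.card V - 1 - D) = _ at hF2
  have hF6 := graphicRank_add_card (S none)
  refine ⟨fun i => fromEdgeSet (S (some i) : Set (Sym2 V)), fromEdgeSet (S none : Set (Sym2 V)),
    fun i => ⟨hle _, ?_⟩, fun i j hij => hdisj' _ _ (by simpa using hij), hle _,
    isAcyclic_of_card_eq_graphicRank (by omega), fun i => hdisj' _ _ (by simp), ?_, by omega⟩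
  · obtain ⟨hT1, hT2⟩ := hS (some i)
    change graphicRank (S (some i)) = graphicRank G.edgeFinset at hT2
    have hT3 := graphicRank_add_card (S (some i))
    have hT4 : Nat.card (fromEdgeSet (S (some i) : Set (Sym2 V))).ConnectedComponent ≤ 1 := by omega
    exact ⟨connected_of_card_connectedComponent_le_one hT4,
      isAcyclic_of_card_eq_graphicRank (hT1.trans hT2.symm)⟩
  · rw [edgeSet_fromEdgeSet_of_subset (hSE none), Set.ncard_coe_finset]
    omega

end SimpleGraph

/-! ### Eigenvalue bounds from quadratic forms on planes -/

namespace Matrix.IsHermitian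

theorem inner_eigenvectorBasis_mulVec {V : Type*} [Fintype V] [DecidableEq V] {M : Matrix V V ℝ}
    (hM : M.IsHermitian) (x : V → ℝ) (i : V) :
    inner ℝ (hM.eigenvectorBasis i) (WithLp.toLp 2 (M.mulVec x)) =
      hM.eigenvalues i * inner ℝ (hM.eigenvectorBasis i) (WithLp.toLp 2 x) := by
  have hT : M.transpose = M := by
    rw [← Matrix.conjTranspose_eq_transpose_of_trivial]; exact hM
  have h := hM.mulVec_eigenvectorBasis i
  simp only [EuclideanSpace.inner_eq_star_dotProduct, star_trivial]
  rw [dotProduct_comm, Matrix.dotProduct_mulVec, ← Matrix.mulVec_transpose, hT, h,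
    smul_dotProduct, smul_eq_mul, dotProduct_comm]

theorem dotProduct_self_eq_sum {V : Type*} [Fintype V] [DecidableEq V] {M : Matrix V V ℝ}
    (hM : M.IsHermitian) (x : V → ℝ) :
    x ⬝ᵥ x = ∑ i, inner ℝ (hM.eigenvectorBasis i) (WithLp.toLp 2 x) ^ 2 := by
  have h := hM.eigenvectorBasis.sum_inner_mul_inner (WithLp.toLp 2 x) (WithLp.toLp 2 x)
  rw [EuclideanSpace.inner_eq_star_dotProduct, star_trivial] at h
  rw [← h]
  refine Finset.sum_congr rfl fun i _ => ?_
  rw [real_inner_comm, sq]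

theorem dotProduct_mulVec_eq_sum {V : Type*} [Fintype V] [DecidableEq V] {M : Matrix V V ℝ}
    (hM : M.IsHermitian) (x : V → ℝ) :
    x ⬝ᵥ M.mulVec x =
      ∑ i, hM.eigenvalues i * inner ℝ (hM.eigenvectorBasis i) (WithLp.toLp 2 x) ^ 2 := by
  have h := hM.eigenvectorBasis.sum_inner_mul_inner (WithLp.toLp 2 x)
    (WithLp.toLp 2 (M.mulVec x))
  rw [EuclideanSpace.inner_eq_star_dotProduct, star_trivial, dotProduct_comm] at h
  rw [← h]
  refine Finset.sum_congr rfl fun i _ => ?_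
  rw [real_inner_comm, hM.inner_eigenvectorBasis_mulVec]
  ring

/-- The plane spanned by `f` and `g` contains a nonzero vector orthogonal to a given one. -/
theorem exists_inner_eq_zero {V : Type*} [Fintype V] {f g : V → ℝ}
    (h : LinearIndependent ℝ ![f, g]) (v : EuclideanSpace ℝ V) :
    ∃ a b : ℝ, 0 < (a • f + b • g) ⬝ᵥ (a • f + b • g) ∧
      inner ℝ v (WithLp.toLp 2 (a • f + b • g)) = 0 := by
  rw [LinearIndependent.pair_iff] at h
  have hpos : ∀ a b : ℝ, ¬ (a = 0 ∧ b = 0) → 0 < (a • f + b • g) ⬝ᵥ (a • f + b • g) := by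
    intro a b hab
    refine lt_of_le_of_ne (Finset.sum_nonneg fun i _ => mul_self_nonneg _) fun h0 => hab ?_
    exact h a b (dotProduct_self_eq_zero.1 h0.symm)
  by_cases h0 : inner ℝ v (WithLp.toLp 2 f) = 0 ∧ inner ℝ v (WithLp.toLp 2 g) = 0
  · exact ⟨1, 0, hpos 1 0 (by simp), by simpa using h0.1⟩
  · refine ⟨inner ℝ v (WithLp.toLp 2 g), -inner ℝ v (WithLp.toLp 2 f), hpos _ _ ?_, ?_⟩
    · rw [neg_eq_zero]; exact fun hh => h0 hh.symm
    · rw [WithLp.toLp_add, WithLp.toLp_smul, WithLp.toLp_smul, inner_add_right, inner_smul_right,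
        inner_smul_right]
      ring

end Matrix.IsHermitian

namespace SimpleGraph

/-- Courant–Fischer: the plane contains a nonzero vector orthogonal to a top eigenvector, and there
the form is at most the second eigenvalue times the squared norm. -/
theorem le_ithLargestEigenvalue_two {V : Type*} [Fintype V] [DecidableEq V] {M : Matrix V V ℝ}
    (hM : M.IsHermitian) (hV : 2 ≤ Fintype.card V) {f g : V → ℝ}
    (h : LinearIndependent ℝ ![f, g]) (s : ℝ)
    (hs : ∀ a b : ℝ, s * ((a • f + b • g) ⬝ᵥ (a • f + b • g)) ≤
      (a • f + b • g) ⬝ᵥ M.mulVec (a • f + b • g)) :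
    s ≤ ithLargestEigenvalue hM 2 := by
  rw [ithLargestEigenvalue, dif_pos ⟨one_le_two, hV⟩]
  -- This is the equivalence by which `eigenvalues` reindexes the sorted `eigenvalues₀`, so `e 0`
  -- carries the largest eigenvalue.
  set e : Fin (Fintype.card V) ≃ V := Fintype.equivOfCardEq (Fintype.card_fin _) with he
  obtain ⟨a, b, hpos, horth⟩ := Matrix.IsHermitian.exists_inner_eq_zero h
    (hM.eigenvectorBasis (e ⟨0, by omega⟩))
  refine le_of_mul_le_mul_right ((hs a b).trans ?_) hpos
  rw [hM.dotProduct_mulVec_eq_sum, hM.dotProduct_self_eq_sum, Finset.mul_sum]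
  refine Finset.sum_le_sum fun i _ => ?_
  by_cases hi : i = e ⟨0, by omega⟩
  · rw [hi, horth]; simp
  · refine mul_le_mul_of_nonneg_right (hM.eigenvalues₀_antitone ?_) (sq_nonneg _)
    rw [Fin.le_def]
    have : (e.symm i : ℕ) ≠ 0 := fun h0 => hi (by
      rw [← e.apply_symm_apply i]; exact congrArg e (Fin.ext h0))
    change 1 ≤ (e.symm i : ℕ)
    omega

/-- The dual argument, with a vector of the plane orthogonal to a bottom eigenvector. -/
theorem ithLargestEigenvalue_pred_card_le {V : Type*} [Fintype V] [DecidableEq V]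
    {M : Matrix V V ℝ} (hM : M.IsHermitian) (hV : 2 ≤ Fintype.card V) {f g : V → ℝ}
    (h : LinearIndependent ℝ ![f, g]) (s : ℝ)
    (hs : ∀ a b : ℝ, (a • f + b • g) ⬝ᵥ M.mulVec (a • f + b • g) ≤
      s * ((a • f + b • g) ⬝ᵥ (a • f + b • g))) :
    ithLargestEigenvalue hM (Fintype.card V - 1) ≤ s := by
  rw [ithLargestEigenvalue, dif_pos ⟨by omega, by omega⟩]
  set e : Fin (Fintype.card V) ≃ V := Fintype.equivOfCardEq (Fintype.card_fin _) with he
  obtain ⟨a, b, hpos, horth⟩ := Matrix.IsHermitian.exists_inner_eq_zero h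
    (hM.eigenvectorBasis (e ⟨Fintype.card V - 1, by omega⟩))
  refine le_of_mul_le_mul_right (le_trans ?_ (hs a b)) hpos
  rw [hM.dotProduct_mulVec_eq_sum, hM.dotProduct_self_eq_sum, Finset.mul_sum]
  refine Finset.sum_le_sum fun i _ => ?_
  by_cases hi : i = e ⟨Fintype.card V - 1, by omega⟩
  · rw [hi, horth]; simp
  · refine mul_le_mul_of_nonneg_right (hM.eigenvalues₀_antitone ?_) (sq_nonneg _)
    rw [Fin.le_def]
    have h1 : (e.symm i : ℕ) ≠ Fintype.card V - 1 := fun h0 => hi (by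
      rw [← e.apply_symm_apply i]; exact congrArg e (Fin.ext h0))
    have h2 := (e.symm i).isLt
    change (e.symm i : ℕ) ≤ Fintype.card V - 1 - 1
    omega

theorem dotProduct_signlessLapMatrix_mulVec {V : Type*} [Fintype V] [DecidableEq V]
    (G : SimpleGraph V) [DecidableRel G.Adj] (x : V → ℝ) :
    x ⬝ᵥ G.signlessLapMatrix.mulVec x =
      2 * ∑ v, (G.degree v : ℝ) * x v ^ 2 - x ⬝ᵥ (G.lapMatrix ℝ).mulVec x := by
  have h : G.signlessLapMatrix + G.lapMatrix ℝ = G.degMatrix ℝ + G.degMatrix ℝ := by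
    rw [signlessLapMatrix, lapMatrix]; abel
  have h' := congrArg (fun M => x ⬝ᵥ M.mulVec x) h
  simp only [Matrix.add_mulVec, dotProduct_add, dotProduct_mulVec_degMatrix] at h'
  have h'' : ∑ v, (G.degree v : ℝ) * x v ^ 2 = ∑ v, (G.degree v : ℝ) * x v * x v :=
    Finset.sum_congr rfl fun v _ => by ring
  rw [h'']
  linarith

/-- A spectral gap for the signless Laplacian or for the Laplacian yields, in every plane,
a vector with large Laplacian quadratic form. -/
theorem exists_lapMatrix_gt {V : Type*} [Fintype V] [DecidableEq V] (G : SimpleGraph V)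
    [DecidableRel G.Adj] (hV : 2 ≤ Fintype.card V) {τ : ℝ}
    (hG : G.signlessLapEigenvalue 2 < 2 * (G.minDegree : ℝ) - τ ∨
      τ < G.lapEigenvalue (Fintype.card V - 1)) {f g : V → ℝ}
    (h : LinearIndependent ℝ ![f, g]) :
    ∃ a b : ℝ, τ * ((a • f + b • g) ⬝ᵥ (a • f + b • g)) <
      (a • f + b • g) ⬝ᵥ (G.lapMatrix ℝ).mulVec (a • f + b • g) := by
  by_contra! hcon
  rcases hG with hG | hG
  · refine hG.not_ge (le_ithLargestEigenvalue_two _ hV h _ fun a b => ?_)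
    rw [dotProduct_signlessLapMatrix_mulVec]
    have h1 := hcon a b
    set x := a • f + b • g
    have h2 : (G.minDegree : ℝ) * (x ⬝ᵥ x) ≤ ∑ v, (G.degree v : ℝ) * x v ^ 2 := by
      rw [dotProduct, Finset.mul_sum]
      refine Finset.sum_le_sum fun v _ => ?_
      rw [← sq]
      exact mul_le_mul_of_nonneg_right (by exact_mod_cast G.minDegree_le_degree v) (sq_nonneg _)
    linarith
  · exact hG.not_ge (ithLargestEigenvalue_pred_card_le _ hV h _ hcon)

end SimpleGraph

/-! ### Counting edges across a vertex partition -/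

namespace SimpleGraph

/-- The number of edges from the part `c` to the part `c'` of the partition given by `p`. -/
def edgesBetween {V κ : Type*} [Fintype V] [DecidableEq κ] (G : SimpleGraph V)
    [DecidableRel G.Adj] (p : V → κ) (c c' : κ) : ℕ :=
  ∑ v with p v = c, (G.neighborFinset v |>.filter fun u => p u = c').card

/-- The number of edges leaving the part `c` of the partition given by `p`. -/
def partBoundary {V κ : Type*} [Fintype V] [DecidableEq κ] (G : SimpleGraph V)
    [DecidableRel G.Adj] (p : V → κ) (c : κ) : ℕ :=
  ∑ v with p v = c, (G.neighborFinset v |>.filter fun u => p u ≠ c).card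

theorem edgesBetween_comm {V κ : Type*} [Fintype V] [DecidableEq κ] (G : SimpleGraph V)
    [DecidableRel G.Adj] (p : V → κ) (c c' : κ) :
    G.edgesBetween p c c' = G.edgesBetween p c' c := by
  have h := Finset.sum_card_bipartiteAbove_eq_sum_card_bipartiteBelow G.Adj
    (s := Finset.univ.filter fun v => p v = c) (t := Finset.univ.filter fun v => p v = c')
  rw [edgesBetween, edgesBetween]
  convert h using 3 with v _ v _
  · ext u; simp [Finset.mem_bipartiteAbove, and_comm]
  · ext u; simp [Finset.mem_bipartiteBelow, and_comm, G.adj_comm]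

theorem partBoundary_eq_sum {V κ : Type*} [Fintype V] [DecidableEq κ] [Fintype κ]
    (G : SimpleGraph V) [DecidableRel G.Adj] (p : V → κ) (c : κ) :
    G.partBoundary p c = ∑ c' ∈ Finset.univ.erase c, G.edgesBetween p c c' := by
  simp only [partBoundary, edgesBetween]
  rw [Finset.sum_comm]
  refine Finset.sum_congr rfl fun v _ => ?_
  rw [Finset.card_eq_sum_card_fiberwise (f := p) (t := Finset.univ.erase c)
    (fun u hu => by simpa using (Finset.mem_filter.1 hu).2)]
  refine Finset.sum_congr rfl fun c' hc' => ?_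
  congr 1
  ext u
  simp only [Finset.mem_filter, Finset.mem_erase] at hc' ⊢
  exact ⟨fun h => ⟨h.1.1, h.2⟩, fun h => ⟨⟨h.1, h.2 ▸ hc'.1⟩, h.2⟩⟩

/-- `edgesBetween p c c` counts ordered pairs, so inner edges already appear twice. -/
theorem sum_degree_part {V κ : Type*} [Fintype V] [DecidableEq κ] (G : SimpleGraph V)
    [DecidableRel G.Adj] (p : V → κ) (c : κ) :
    ∑ v with p v = c, G.degree v = G.edgesBetween p c c + G.partBoundary p c := by
  rw [edgesBetween, partBoundary, ← Finset.sum_add_distrib]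
  refine Finset.sum_congr rfl fun v _ => ?_
  rw [← card_neighborFinset_eq_degree, Finset.card_filter_add_card_filter_not]

/-- An edge joining different parts is not in H, and it is counted once from each end. -/
theorem sum_partBoundary_le {V κ : Type*} [Fintype V] [DecidableEq V] [DecidableEq κ] [Fintype κ]
    (G H : SimpleGraph V) [DecidableRel G.Adj] (p : V → κ)
    (hp : ∀ u v, H.Adj u v → p u = p v) :
    ∑ c, G.partBoundary p c ≤ 2 * (G \ H).edgeSet.ncard := by
  classical
  have h : 2 * (G \ H).edgeSet.ncard = ∑ v, (G \ H).degree v := by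
    rw [sum_degrees_eq_twice_card_edges, ← Set.ncard_coe_finset, coe_edgeFinset]
  rw [h]
  simp only [partBoundary]
  rw [← Finset.sum_fiberwise (s := Finset.univ) (g := p)]
  refine Finset.sum_le_sum fun c _ => Finset.sum_le_sum fun v hv => ?_
  rw [← card_neighborFinset_eq_degree]
  refine Finset.card_le_card fun u hu => ?_
  simp only [Finset.mem_filter, mem_neighborFinset, Finset.mem_univ, true_and, sdiff_adj] at hu hv ⊢
  exact ⟨hu.1, fun h => hu.2 ((hp v u h).symm.trans hv)⟩

/-- A part with at most `δ` vertices is left by at least `δ` edges. -/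
theorem minDegree_le_partBoundary {V κ : Type*} [Fintype V] [DecidableEq V] [DecidableEq κ]
    (G : SimpleGraph V) [DecidableRel G.Adj] (p : V → κ) (c : κ)
    (hne : (Finset.univ.filter fun v => p v = c).Nonempty)
    (hle : (Finset.univ.filter fun v => p v = c).card ≤ G.minDegree) :
    G.minDegree ≤ G.partBoundary p c := by
  set X := Finset.univ.filter fun v => p v = c with hX
  have hpos := hne.card_pos
  have key : ∀ v ∈ X, G.minDegree + 1 - X.card ≤
      (G.neighborFinset v |>.filter fun u => p u ≠ c).card := by
    intro v hv
    have h1 := G.minDegree_le_degree v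
    rw [← card_neighborFinset_eq_degree,
      ← Finset.card_filter_add_card_filter_not (fun u => p u = c)] at h1
    have h2 : (G.neighborFinset v |>.filter fun u => p u = c).card ≤ (X.erase v).card := by
      refine Finset.card_le_card fun u hu => ?_
      rw [Finset.mem_filter, mem_neighborFinset] at hu
      exact Finset.mem_erase.2 ⟨hu.1.ne', by simp [hX, hu.2]⟩
    rw [Finset.card_erase_of_mem hv] at h2
    simp only [ne_eq]
    omega
  have h := Finset.card_nsmul_le_sum X _ _ key
  rw [smul_eq_mul] at h
  refine le_trans ?_ h
  -- With |X| = a + 1 and δ = |X| + b, the bound |X|(δ + 1 - |X|) is (a+1)(b+1) ≥ a + b + 1 = δ.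
  obtain ⟨a, ha⟩ := Nat.exists_eq_add_of_lt hpos
  obtain ⟨b, hb⟩ := Nat.exists_eq_add_of_le hle
  rw [hb, show X.card + b + 1 - X.card = b + 1 by omega, ha]
  nlinarith [Nat.zero_le (a * b)]

/-- The real indicator function of a part. -/
def partIndicator {V κ : Type*} [DecidableEq κ] (p : V → κ) (c : κ) (v : V) : ℝ :=
  if p v = c then 1 else 0

theorem partIndicator_dotProduct {V κ : Type*} [Fintype V] [DecidableEq κ] (p : V → κ) (c : κ)
    (x : V → ℝ) : partIndicator p c ⬝ᵥ x = ∑ v with p v = c, x v := by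
  simp [dotProduct, partIndicator, Finset.sum_filter]

theorem partIndicator_dotProduct_self {V κ : Type*} [Fintype V] [DecidableEq κ] (p : V → κ)
    (c : κ) : partIndicator p c ⬝ᵥ partIndicator p c =
      ((Finset.univ.filter fun v => p v = c).card : ℝ) := by
  rw [partIndicator_dotProduct, Finset.card_eq_sum_ones, Nat.cast_sum]
  refine Finset.sum_congr rfl fun v hv => ?_
  simp [partIndicator, (Finset.mem_filter.1 hv).2]

theorem partIndicator_dotProduct_of_ne {V κ : Type*} [Fintype V] [DecidableEq κ] (p : V → κ)
    {c c' : κ} (h : c ≠ c') : partIndicator p c ⬝ᵥ partIndicator p c' = 0 := by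
  rw [partIndicator_dotProduct]
  refine Finset.sum_eq_zero fun v hv => ?_
  simp [partIndicator, (Finset.mem_filter.1 hv).2, h]

theorem lapMatrix_mulVec_partIndicator {V κ : Type*} [Fintype V] [DecidableEq V] [DecidableEq κ]
    (G : SimpleGraph V) [DecidableRel G.Adj] (p : V → κ) (c : κ) (v : V) :
    (G.lapMatrix ℝ).mulVec (partIndicator p c) v = G.degree v * partIndicator p c v -
      ((G.neighborFinset v |>.filter fun u => p u = c).card : ℝ) := by
  rw [lapMatrix_mulVec_apply]
  simp [partIndicator]

theorem partIndicator_lapMatrix_self {V κ : Type*} [Fintype V] [DecidableEq V] [DecidableEq κ]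
    (G : SimpleGraph V) [DecidableRel G.Adj] (p : V → κ) (c : κ) :
    partIndicator p c ⬝ᵥ (G.lapMatrix ℝ).mulVec (partIndicator p c) = G.partBoundary p c := by
  have h : ∑ v with p v = c, (G.degree v : ℝ) =
      G.edgesBetween p c c + G.partBoundary p c := by exact_mod_cast G.sum_degree_part p c
  rw [partIndicator_dotProduct]
  simp only [lapMatrix_mulVec_partIndicator]
  rw [Finset.sum_sub_distrib, ← Nat.cast_sum, ← edgesBetween]
  rw [Finset.sum_congr rfl (g := fun v => (G.degree v : ℝ)) fun v hv => by
    simp [partIndicator, (Finset.mem_filter.1 hv).2], h]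
  ring

theorem partIndicator_lapMatrix_of_ne {V κ : Type*} [Fintype V] [DecidableEq V] [DecidableEq κ]
    (G : SimpleGraph V) [DecidableRel G.Adj] (p : V → κ) {c c' : κ} (hc : c ≠ c') :
    partIndicator p c ⬝ᵥ (G.lapMatrix ℝ).mulVec (partIndicator p c') =
      -(G.edgesBetween p c c' : ℝ) := by
  rw [partIndicator_dotProduct]
  simp only [lapMatrix_mulVec_partIndicator]
  rw [Finset.sum_sub_distrib, ← Nat.cast_sum, ← edgesBetween, Finset.sum_eq_zero fun v hv => by
    simp [partIndicator, (Finset.mem_filter.1 hv).2, hc], zero_sub]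

theorem linearIndependent_partIndicator {V κ : Type*} [DecidableEq κ] {p : V → κ}
    (hp : Function.Surjective p) {c c' : κ} (hc : c ≠ c') :
    LinearIndependent ℝ ![partIndicator p c, partIndicator p c'] := by
  rw [LinearIndependent.pair_iff]
  intro a b h
  obtain ⟨v, rfl⟩ := hp c
  obtain ⟨w, rfl⟩ := hp c'
  have h1 := congrFun h v
  have h2 := congrFun h w
  simp [partIndicator, hc, hc.symm] at h1 h2
  exact ⟨h1, h2⟩

/-- Two large parts with few leaving edges are joined by many edges. -/
theorem le_edgesBetween {V κ : Type*} [Fintype V] [DecidableEq V] [DecidableEq κ]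
    (G : SimpleGraph V) [DecidableRel G.Adj] {p : V → κ} (hp : Function.Surjective p) {m : ℕ}
    {τ : ℝ} (hτ : 0 ≤ τ)
    (hG : ∀ f g : V → ℝ, LinearIndependent ℝ ![f, g] →
      ∃ a b : ℝ, τ * ((a • f + b • g) ⬝ᵥ (a • f + b • g)) <
        (a • f + b • g) ⬝ᵥ (G.lapMatrix ℝ).mulVec (a • f + b • g))
    {c c' : κ} (hcc : c ≠ c') (hc : m ≤ (Finset.univ.filter fun v => p v = c).card)
    (hc' : m ≤ (Finset.univ.filter fun v => p v = c').card)
    (hle : G.partBoundary p c ≤ G.partBoundary p c') :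
    τ * m - G.partBoundary p c' ≤ G.edgesBetween p c c' := by
  obtain ⟨a, b, hab⟩ := hG _ _ (linearIndependent_partIndicator hp hcc)
  simp only [Matrix.mulVec_add, Matrix.mulVec_smul, dotProduct_add, add_dotProduct,
    smul_dotProduct, dotProduct_smul, smul_eq_mul, partIndicator_lapMatrix_self,
    partIndicator_lapMatrix_of_ne G p hcc, partIndicator_lapMatrix_of_ne G p hcc.symm,
    partIndicator_dotProduct_self, partIndicator_dotProduct_of_ne p hcc,
    partIndicator_dotProduct_of_ne p hcc.symm, G.edgesBetween_comm p c' c] at hab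
  -- Otherwise e ≤ τ|X| - d and e ≤ τ|Y| - d' for the part sizes |X|, |Y|. Weighting by a² and b²
  -- shows that τ times the squared norm exceeds the Laplacian form by at least e(a+b)² ≥ 0, against
  -- `hab`.
  by_contra! hlt
  have hc₁ : τ * m ≤ τ * (Finset.univ.filter fun v => p v = c).card :=
    mul_le_mul_of_nonneg_left (by exact_mod_cast hc) hτ
  have hc₂ : τ * m ≤ τ * (Finset.univ.filter fun v => p v = c').card :=
    mul_le_mul_of_nonneg_left (by exact_mod_cast hc') hτ
  have hle' : (G.partBoundary p c : ℝ) ≤ G.partBoundary p c' := by exact_mod_cast hle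
  have he : (0 : ℝ) ≤ G.edgesBetween p c c' := Nat.cast_nonneg _
  generalize (G.edgesBetween p c c' : ℝ) = e at *
  generalize (G.partBoundary p c : ℝ) = d at *
  generalize (G.partBoundary p c' : ℝ) = d' at *
  have h1 := mul_le_mul_of_nonneg_left (show e ≤ τ *
    (Finset.univ.filter fun v => p v = c).card - d by linarith) (sq_nonneg a)
  have h2 := mul_le_mul_of_nonneg_left (show e ≤ τ *
    (Finset.univ.filter fun v => p v = c').card - d' by linarith) (sq_nonneg b)
  nlinarith [mul_nonneg he (sq_nonneg (a + b))]

/-- The part c of least boundary is compared with every other part of L; the edges from c to these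
parts number at most the boundary of c. -/
theorem le_sum_partBoundary {V κ : Type*} [Fintype V] [DecidableEq V] [DecidableEq κ] [Fintype κ]
    (G : SimpleGraph V) [DecidableRel G.Adj] {p : V → κ} (hp : Function.Surjective p) {m : ℕ}
    {τ : ℝ} (hτ : 0 ≤ τ)
    (hG : ∀ f g : V → ℝ, LinearIndependent ℝ ![f, g] →
      ∃ a b : ℝ, τ * ((a • f + b • g) ⬝ᵥ (a • f + b • g)) <
        (a • f + b • g) ⬝ᵥ (G.lapMatrix ℝ).mulVec (a • f + b • g))
    {L : Finset κ} (hne : L.Nonempty)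
    (hL : ∀ c ∈ L, m ≤ (Finset.univ.filter fun v => p v = c).card) :
    τ * m * ((L.card : ℝ) - 1) ≤ ∑ c ∈ L, (G.partBoundary p c : ℝ) := by
  obtain ⟨c, hc, hmin⟩ := L.exists_min_image (fun c => G.partBoundary p c) hne
  have h1 : ∑ c' ∈ L.erase c, (G.edgesBetween p c c' : ℝ) ≤ G.partBoundary p c := by
    rw [partBoundary_eq_sum, Nat.cast_sum]
    exact Finset.sum_le_sum_of_subset_of_nonneg (Finset.erase_subset_erase _ (Finset.subset_univ _))
      fun _ _ _ => Nat.cast_nonneg _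
  have h2 : ∑ c' ∈ L.erase c, (τ * m - G.partBoundary p c') ≤
      ∑ c' ∈ L.erase c, (G.edgesBetween p c c' : ℝ) :=
    Finset.sum_le_sum fun c' hc' => G.le_edgesBetween hp hτ hG (Finset.ne_of_mem_erase hc').symm
      (hL c hc) (hL c' (Finset.mem_of_mem_erase hc')) (hmin c' (Finset.mem_of_mem_erase hc'))
  rw [Finset.sum_sub_distrib, Finset.sum_const, Finset.card_erase_of_mem hc, nsmul_eq_mul,
    Nat.cast_sub hne.card_pos, Nat.cast_one] at h2
  rw [← Finset.add_sum_erase L _ hc]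
  linarith

/-- The number of edges between the components of a subgraph, in terms of the number `l` of
components with more than `δ` vertices. -/
theorem card_edges_between_components {V : Type*} [Fintype V] [DecidableEq V]
    (G : SimpleGraph V) [DecidableRel G.Adj] {k : ℕ} (hk : 2 * k + 2 ≤ G.minDegree) {τ : ℝ}
    (hτ : τ * ((G.minDegree : ℝ) + 1) =
      2 * ((k : ℝ) + ((G.minDegree : ℝ) - 1) / (G.minDegree : ℝ)))
    (hG : ∀ f g : V → ℝ, LinearIndependent ℝ ![f, g] →
      ∃ a b : ℝ, τ * ((a • f + b • g) ⬝ᵥ (a • f + b • g)) <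
        (a • f + b • g) ⬝ᵥ (G.lapMatrix ℝ).mulVec (a • f + b • g))
    (H : SimpleGraph V) :
    ∃ l : ℕ, l ≤ Nat.card H.ConnectedComponent ∧ l * (G.minDegree + 1) ≤ Fintype.card V ∧
      G.minDegree * ((k + 1) * (Nat.card H.ConnectedComponent - 1)) ≤
        G.minDegree * (G \ H).edgeSet.ncard + (l - 1) := by
  classical
  set p : V → H.ConnectedComponent := H.connectedComponentMk with hp
  have hsurj : Function.Surjective p := Quot.mk_surjective
  set δ := G.minDegree with hδ
  set L := Finset.univ.filter fun c : H.ConnectedComponent =>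
    δ + 1 ≤ (Finset.univ.filter fun v => p v = c).card with hL
  have hsmall : ∀ c ∈ Lᶜ, 2 * k + 2 ≤ G.partBoundary p c := by
    intro c hc
    refine hk.trans (G.minDegree_le_partBoundary p c ?_ ?_)
    · obtain ⟨v, hv⟩ := hsurj c
      exact ⟨v, by simpa using hv⟩
    · simp only [hL, Finset.mem_compl, Finset.mem_filter, Finset.mem_univ, true_and] at hc
      omega
  have hsum := G.sum_partBoundary_le H p fun u v h => ConnectedComponent.sound h.reachable
  have hsmall' := Finset.card_nsmul_le_sum _ _ _ hsmall
  rw [smul_eq_mul] at hsmall'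
  rw [← Finset.sum_add_sum_compl L] at hsum
  have hcard := Finset.card_add_card_compl L
  rw [Nat.card_eq_fintype_card]
  refine ⟨L.card, Finset.card_le_univ L, ?_, ?_⟩
  · have h1 := Finset.card_nsmul_le_sum L
      (fun c => (Finset.univ.filter fun v => p v = c).card) (δ + 1)
      fun c hc => (Finset.mem_filter.1 hc).2
    rw [smul_eq_mul] at h1
    refine h1.trans ((Finset.sum_le_sum_of_subset (Finset.subset_univ L)).trans_eq ?_)
    exact (Finset.card_eq_sum_card_fiberwise fun v _ => Finset.mem_univ _).symm
  · rcases L.eq_empty_or_nonempty with h0 | hne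
    · rw [Finset.card_eq_zero.2 h0, zero_add] at hcard
      rw [hcard] at hsmall'
      refine le_trans (Nat.mul_le_mul_left δ ?_) (Nat.le_add_right _ _)
      refine (Nat.mul_le_mul_left (k + 1) (Nat.sub_le _ 1)).trans ?_
      have := hsmall'.trans ((Nat.le_add_left _ _).trans hsum)
      linarith
    · have hδ0 : (0 : ℝ) < δ := by exact_mod_cast (show 0 < δ by omega)
      have hδ1 : (1 : ℝ) ≤ δ := by exact_mod_cast (show 1 ≤ δ by omega)
      have hτ0 : 0 ≤ τ := by
        refine nonneg_of_mul_nonneg_left (b := (δ : ℝ) + 1) ?_ (by positivity)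
        rw [hτ]
        have : 0 ≤ ((δ : ℝ) - 1) / δ := div_nonneg (by linarith) hδ0.le
        positivity
      have hlarge := G.le_sum_partBoundary hsurj (m := δ + 1) hτ0 hG hne
        fun c hc => (Finset.mem_filter.1 hc).2
      push_cast at hlarge
      rw [hτ] at hlarge
      have hl1 : 1 ≤ L.card := hne.card_pos
      have hsumR : ∑ c ∈ L, (G.partBoundary p c : ℝ) + ((Lᶜ).card : ℝ) * (2 * k + 2) ≤
          2 * ((G \ H).edgeSet.ncard : ℝ) := by
        exact_mod_cast (Nat.add_le_add_left hsmall' _).trans hsum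
      obtain ⟨l, hl⟩ := Nat.exists_eq_add_of_le' hl1
      rw [← hcard, hl, show l + 1 + Lᶜ.card - 1 = l + Lᶜ.card by omega, Nat.add_sub_cancel]
      rw [hl] at hlarge
      push_cast at hlarge
      rw [add_sub_cancel_right] at hlarge
      have h2 := mul_le_mul_of_nonneg_left (hlarge.trans (le_sub_iff_add_le.2 hsumR)) hδ0.le
      have h3 : (δ : ℝ) * (2 * (k + (δ - 1) / δ) * l) = 2 * (δ * k + (δ - 1)) * l := by
        field_simp
      rw [h3] at h2
      have h4 : (δ : ℝ) * ((k + 1) * (l + Lᶜ.card)) ≤ δ * (G \ H).edgeSet.ncard + l := by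
        linarith
      exact_mod_cast h4

/-! ### From edge counts to property P -/

theorem hasPropertyP_minDegree {V : Type*} [Fintype V] [DecidableEq V] [Nonempty V]
    (G : SimpleGraph V) [DecidableRel G.Adj] {k : ℕ} (hk1 : 1 ≤ k)
    (hk : 2 * k + 2 ≤ G.minDegree) {τ : ℝ}
    (hτ : τ * ((G.minDegree : ℝ) + 1) =
      2 * ((k : ℝ) + ((G.minDegree : ℝ) - 1) / (G.minDegree : ℝ)))
    (hG : ∀ f g : V → ℝ, LinearIndependent ℝ ![f, g] →
      ∃ a b : ℝ, τ * ((a • f + b • g) ⬝ᵥ (a • f + b • g)) <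
        (a • f + b • g) ⬝ᵥ (G.lapMatrix ℝ).mulVec (a • f + b • g)) :
    G.HasPropertyP k G.minDegree := by
  have hbound := G.card_edges_between_components hk hτ hG
  have hn : G.minDegree + 1 ≤ Fintype.card V := by
    obtain ⟨v⟩ := ‹Nonempty V›
    exact (Nat.succ_le_succ (G.minDegree_le_degree v)).trans (G.degree_lt_card_verts v)
  set δ := G.minDegree with hδ
  set n := Fintype.card V with hn'
  set m := n / (δ + 1) with hm
  have hm1 : 1 ≤ m := (Nat.one_le_div_iff (by omega)).2 hn
  have hmn : m * (δ + 1) ≤ n := Nat.div_mul_le_self n (δ + 1)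
  -- The deficiency is at most (m-1)/δ; it may be rounded down because edge counts are integers.
  set D := (m - 1) / δ with hD
  have hDm : D * δ ≤ m - 1 := Nat.div_mul_le_self _ _
  have hDlt : m - 1 < δ * (D + 1) := Nat.lt_mul_div_succ _ (by omega)
  have hmδ : m ≤ m * δ := Nat.le_mul_of_pos_right m (by omega)
  have hDδ : D ≤ D * δ := Nat.le_mul_of_pos_right D (by omega)
  rw [mul_add, mul_one] at hmn
  obtain ⟨T, F, hT, hTT, hFG, hF, hTF, hFcard, hFcomp⟩ := G.exists_trees_and_forest (D := D) hk1
    (by omega) (fun H _ => by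
      obtain ⟨l, hl, -, h⟩ := hbound H
      -- Here l - 1 is at most s - 1, so the loss (l-1)/δ costs at most one of the k + 1 trees.
      have hl' : l - 1 ≤ Nat.card H.ConnectedComponent - 1 := Nat.sub_le_sub_right hl 1
      generalize Nat.card H.ConnectedComponent - 1 = t at h hl' ⊢
      by_contra! hlt
      have h1 := Nat.mul_le_mul_left δ (Nat.succ_le_of_lt hlt)
      have h2 : t ≤ δ * t := Nat.le_mul_of_pos_left t (by omega)
      rw [Nat.succ_eq_add_one, mul_add] at h1
      rw [add_mul, one_mul, mul_add] at h
      omega) (fun H _ => by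
      obtain ⟨l, -, hl, h⟩ := hbound H
      have hlm : l ≤ m := (Nat.le_div_iff_mul_le (by omega)).2 hl
      by_contra! hlt
      have h1 := Nat.mul_le_mul_left δ (Nat.succ_le_of_lt hlt)
      rw [Nat.succ_eq_add_one, add_assoc, mul_add] at h1
      omega)
  refine ⟨T, F, hT, hTT, hFG, hF, hTF, ?_, fun _ => ?_⟩
  · have hδ0 : (0 : ℝ) < δ := by exact_mod_cast (show 0 < δ by omega)
    have h1 : (F.edgeSet.ncard : ℝ) = n - (D + 1) := by
      rw [eq_sub_iff_add_eq]; exact_mod_cast hFcard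
    have h2 : (D : ℝ) * δ < n - 1 := by
      rw [lt_sub_iff_add_lt]; exact_mod_cast (show D * δ + 1 < n by omega)
    rw [h1, gt_iff_lt, div_mul_eq_mul_div, div_lt_iff₀ hδ0]
    linarith
  · classical
    -- (D+1)δ ≤ m - 1 + δ < n, so some component has more than δ vertices, whether or not F is a
    -- tree.
    have hlt : Fintype.card F.ConnectedComponent * δ < Fintype.card V := by
      rw [← Nat.card_eq_fintype_card, hFcomp, add_mul, one_mul]
      have : δ ≤ m * δ := Nat.le_mul_of_pos_left δ hm1
      omega
    obtain ⟨C, hC⟩ := Fintype.exists_lt_card_fiber_of_mul_lt_card F.connectedComponentMk hlt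
    refine ⟨C, ?_⟩
    have h1 := C.connected_toSimpleGraph.card_vert_le_card_edgeSet_add_one
    rw [Nat.card_coe_set_eq] at h1
    have h2 : (Finset.univ.filter fun v => F.connectedComponentMk v = C).card = Nat.card C := by
      rw [Nat.card_eq_fintype_card, ← Fintype.card_subtype]
      rfl
    omega

end SimpleGraph

theorem corollary5p3 {V : Type*} [Fintype V] [DecidableEq V] (G : SimpleGraph V)
    [DecidableRel G.Adj] (k δ Δ : ℕ) (hk : 1 ≤ k) (hδ : δ = G.minDegree) (hΔ : Δ = G.maxDegree)
    (hδk : 2 * k + 2 ≤ δ) :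
    (G.signlessLapEigenvalue 2 <
        2 * (δ : ℝ) - 2 * ((k : ℝ) + ((δ : ℝ) - 1) / (δ : ℝ)) / ((δ : ℝ) + 1) →
      G.HasPropertyP k δ) ∧
    (G.lapEigenvalue (Fintype.card V - 1) >
        (Δ : ℝ) - (δ : ℝ) + 2 * ((k : ℝ) + ((δ : ℝ) - 1) / (δ : ℝ)) / ((δ : ℝ) + 1) →
      G.HasPropertyP k δ) := by
  subst hδ hΔ
  have hV : Nonempty V := by
    by_contra h
    rw [not_nonempty_iff] at h
    -- The minimum degree of the empty graph is 0 by convention.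
    rw [SimpleGraph.minDegree_of_subsingleton] at hδk
    omega
  obtain ⟨v⟩ := id hV
  have hcard : 2 ≤ Fintype.card V := by
    have h1 := G.minDegree_le_degree v
    have h2 := G.degree_lt_card_verts v
    omega
  have hle : (G.minDegree : ℝ) ≤ G.maxDegree := by
    exact_mod_cast (G.minDegree_le_degree v).trans (G.degree_le_maxDegree v)
  have hτ : 2 * ((k : ℝ) + ((G.minDegree : ℝ) - 1) / (G.minDegree : ℝ)) /
      ((G.minDegree : ℝ) + 1) * ((G.minDegree : ℝ) + 1) =
      2 * ((k : ℝ) + ((G.minDegree : ℝ) - 1) / (G.minDegree : ℝ)) :=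
    div_mul_cancel₀ _ (by positivity)
  refine ⟨fun h => G.hasPropertyP_minDegree hk hδk hτ fun f g hfg =>
      G.exists_lapMatrix_gt hcard (Or.inl h) hfg,
    fun h => G.hasPropertyP_minDegree hk hδk hτ fun f g hfg =>
      G.exists_lapMatrix_gt hcard (Or.inr ?_) hfg⟩
  -- Since Δ ≥ δ, the term Δ - δ can be dropped.
  linarith
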